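/- Let $d\ge 2$ and $r\ge 1$ be integers, and let $X$ be a set of at least $(d+1)(r-1)+1$ and at most $(d+1)r$ points in $\mathbb{R}^d$. Then $X$ can be partitioned into $r$ pairwise disjoint sets $X_1,\ldots,X_r$, each of size at most $d+1$, whose convex hulls all have a point in common. Moreover, for any two distinct indices $i\neq j$ such that $X_i$ and $X_j$ both have size $d+1$, the convex hulls $\operatorname{conv}(X_i)$ and $\operatorname{conv}(X_j)$ cross, meaning that their topological boundaries in $\mathbb{R}^d$ (not the relative boundaries) have a non-empty intersection. -/

import Mathlib

/-- Two convex bodies `A`, `B` in `ℝ^d` cross if their boundaries (taken in `ℝ^d`, not relative to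
the affine hulls) have a common point. -/
def Cross {d : ℕ} (A B : Set (EuclideanSpace ℝ (Fin d))) : Prop :=
  (frontier A ∩ frontier B).Nonempty

/-!
The proof starts from a partition with a common point `p` and uncrosses nested pairs.

The initial partition is Tverberg's theorem with parts of size at most `d + 1`
(`exists_partition_of_card`), which rests on the colourful Carathéodory theorem.

Among all such partitions for the same `p`, choose one minimising the sum over the parts of `3 ^ N`,
where `N` is the number of points of `X` in the hull of the part. Suppose two parts of size `d + 1`
do not cross. As their hulls share `p` and frontiers of convex bodies are connected for `d ≥ 2`, one
hull lies in the interior of the other (`nested_of_frontier_inter_eq_empty`). The `2d + 2` points of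
the two parts admit another splitting into halves with `p` in both hulls (`exists_repartition`). The
hull of each new half misses a vertex of the outer simplex, so its `N` is smaller than that of the
outer hull, and since `3 ^ n + 3 ^ n < 3 ^ (n + 1)` the potential drops: a contradiction.

The other splitting exists by parity. For generic `q`, each `d + 2` points span an even number of
simplices containing `q` (`even_card_mem_convexHull_erase`), so the indicator of "`q` is in the hull
of `A`" is a mod 2 cocycle on sets `A` of size `d + 1`, and a double count shows that the number of
splittings of `2d + 2` points into halves on which a mod 2 cocycle does not vanish is even
(`exists_ne_of_cocycle`). The point `p` need not be generic, but a nearby `q` is, and being outside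
the hull is an open condition.
-/

/-! ### The colourful Carathéodory theorem -/

/-- The hyperplane through a point `m` of least norm in a convex set, orthogonal to `m`, supports the
set. -/
theorem norm_sq_le_inner_of_forall_norm_le {F : Type*} [NormedAddCommGroup F]
    [InnerProductSpace ℝ F] {K : Set F} (hK : Convex ℝ K) {m : F} (hm : m ∈ K)
    (hmin : ∀ w ∈ K, ‖m‖ ≤ ‖w‖) {w : F} (hw : w ∈ K) : ‖m‖ ^ 2 ≤ inner ℝ m w := by
  have h : ‖(0 : F) - m‖ = ⨅ w : K, ‖(0 : F) - w‖ := by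
    have : Nonempty K := ⟨⟨m, hm⟩⟩
    apply le_antisymm
    · exact le_ciInf fun w => by simpa using hmin w w.2
    · exact ciInf_le ⟨0, by rintro _ ⟨w, rfl⟩; exact norm_nonneg _⟩ (⟨m, hm⟩ : K)
  have := (norm_eq_iInf_iff_real_inner_le_zero hK hm).1 h w hw
  rw [zero_sub, inner_neg_left, inner_sub_right, real_inner_self_eq_norm_sq] at this
  linarith

/-- **Colourful Carathéodory theorem** (Bárány). If each of more than `finrank F` families of points has
the origin in its convex hull, one can pick a point from each family so that the origin lies in the
convex hull of the picked points. Among all choices take one whose hull is nearest to the origin: if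
the distance is positive, the nearest point is a combination of linearly independent picked points,
so some family is not needed, and its point can be exchanged for one that brings the hull closer. -/
theorem colorful_caratheodory {F : Type*} [NormedAddCommGroup F] [InnerProductSpace ℝ F]
    [FiniteDimensional ℝ F] {ι κ : Type*} [Fintype ι] [Finite κ]
    (hι : Module.finrank ℝ F < Fintype.card ι) (v : ι → κ → F)
    (h0 : ∀ i, (0 : F) ∈ convexHull ℝ (Set.range (v i))) :
    ∃ s : ι → κ, (0 : F) ∈ convexHull ℝ (Set.range fun i => v i (s i)) := by
  classical
  have hιne : Nonempty ι := Fintype.card_pos_iff.1 (by omega)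
  have hκ : Nonempty κ := by
    have := (convexHull_nonempty_iff (𝕜 := ℝ)).1 ⟨0, h0 hιne.some⟩
    exact Set.range_nonempty_iff_nonempty.1 this
  let K : (ι → κ) → Set F := fun s => convexHull ℝ (Set.range fun i => v i (s i))
  have hKc (s) : IsCompact (K s) := (Set.finite_range _).isCompact_convexHull ℝ
  have hKne (s) : (K s).Nonempty := (Set.range_nonempty _).convexHull
  obtain ⟨s, hs⟩ := Finite.exists_min fun s => Metric.infDist (0 : F) (K s)
  obtain ⟨m, hm, hmd⟩ := (hKc s).exists_infDist_eq_dist (hKne s) 0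
  rw [dist_zero_left] at hmd
  have hle (s') {w : F} (hw : w ∈ K s') : ‖m‖ ≤ ‖w‖ := by
    rw [← hmd, ← dist_zero_left w]
    exact (hs s').trans (Metric.infDist_le_dist_of_mem hw)
  refine ⟨s, ?_⟩
  by_cases hm0 : m = 0
  · exact hm0 ▸ hm
  exfalso
  have hpos : 0 < ‖m‖ ^ 2 := by positivity
  have hsup {w : F} (hw : w ∈ K s) : ‖m‖ ^ 2 ≤ inner ℝ m w :=
    norm_sq_le_inner_of_forall_norm_le (convex_convexHull ℝ _) hm (fun _ h => hle s h) hw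
  obtain ⟨τ, _, z, w, hz, hzi, hwpos, hwsum, hwm⟩ := eq_pos_convex_span_of_mem_convexHull hm
  -- every point carrying positive weight lies on the supporting hyperplane at `m`
  have hplane (k : τ) : inner ℝ m (z k) = ‖m‖ ^ 2 := by
    have hge (k) : ‖m‖ ^ 2 ≤ inner ℝ m (z k) := hsup (subset_convexHull ℝ _ (hz ⟨k, rfl⟩))
    have htot : ∑ k, w k * (inner ℝ m (z k) - ‖m‖ ^ 2) = 0 := by
      simp only [mul_sub, Finset.sum_sub_distrib, ← Finset.sum_mul, hwsum]
      rw [← real_inner_self_eq_norm_sq m]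
      conv_lhs => rw [one_mul]; arg 2; arg 3; rw [← hwm]
      simp [inner_sum, inner_smul_right]
    have := (Finset.sum_eq_zero_iff_of_nonneg fun k _ =>
      mul_nonneg (hwpos k).le (sub_nonneg.2 (hge k))).1 htot k (Finset.mem_univ k)
    rcases mul_eq_zero.1 this with h | h
    · exact absurd h (hwpos k).ne'
    · linarith
  -- that hyperplane misses the origin, so affine independence becomes linear independence
  have hlin : LinearIndependent ℝ z := by
    rw [Fintype.linearIndependent_iff]
    intro c hc
    have hc0 : ∑ k, c k = 0 := by
      have h1 : ∑ k, c k * ‖m‖ ^ 2 = 0 := by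
        have := congrArg (inner ℝ m) hc
        simpa [inner_sum, inner_smul_right, hplane] using this
      rw [← Finset.sum_mul] at h1
      exact (mul_eq_zero.1 h1).resolve_right hpos.ne'
    intro k
    refine (affineIndependent_iff.1 hzi) Finset.univ c hc0 hc k (Finset.mem_univ k)
  have hcard := hlin.fintype_card_le_finrank
  choose f hf using fun k => hz ⟨k, rfl⟩
  obtain ⟨i, hi⟩ : ∃ i, i ∉ Set.range f := by
    by_contra! h
    have := Fintype.card_le_of_surjective f h
    omega
  obtain ⟨k, hk⟩ : ∃ k, inner ℝ m (v i k) ≤ 0 := by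
    by_contra! h
    have hsub : convexHull ℝ (Set.range (v i)) ⊆ {x | 0 < inner ℝ m x} :=
      convexHull_min (by rintro _ ⟨k, rfl⟩; exact h k)
        (convex_halfSpace_gt (innerₛₗ ℝ m).isLinear 0)
    simpa using hsub (h0 i)
  have hmem : m ∈ K (Function.update s i k) := by
    rw [← hwm]
    refine (convex_convexHull ℝ _).sum_mem (fun k _ => (hwpos k).le) hwsum fun j _ =>
      subset_convexHull ℝ _ ⟨f j, ?_⟩
    have : f j ≠ i := fun h => hi ⟨j, h⟩
    simpa [Function.update_of_ne this] using hf j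
  have hu : v i k ∈ K (Function.update s i k) := subset_convexHull ℝ _ ⟨i, by simp⟩
  have := norm_sq_le_inner_of_forall_norm_le (convex_convexHull ℝ _) hmem
    (fun _ h => hle _ h) hu
  linarith

/-! ### Tverberg's theorem -/

/-- **Tverberg's theorem**, by Sarkaria's construction. Write `x̂ = (1, x)` and let `e 0, …, e n` be
vectors of `ℝⁿ` whose only linear relation, up to scaling, is `∑ j, e j = 0`. The points
`e j ⊗ x̂`, with `j` varying, form the family of `x`. A colourful choice `x ↦ j = s x` with the
origin in its hull is a weighting of the points for which the weighted sums of `x̂` over the classes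
of `s` all agree. The classes are the fibres of `s` in `X`. -/
theorem exists_common_point_of_card {d r : ℕ} (hr : 1 ≤ r)
    (X : Finset (EuclideanSpace ℝ (Fin d))) (hX : (d + 1) * (r - 1) + 1 ≤ X.card) :
    ∃ (p : EuclideanSpace ℝ (Fin d)) (s : EuclideanSpace ℝ (Fin d) → Fin r),
      ∀ j, p ∈ convexHull ℝ ((X.filter fun x => s x = j : Finset _) : Set _) := by
  classical
  obtain ⟨n, rfl⟩ : ∃ n, r = n + 1 := ⟨r - 1, by omega⟩
  rw [Nat.add_sub_cancel] at hX
  let hat : EuclideanSpace ℝ (Fin d) → Option (Fin d) → ℝ := fun x c => c.elim 1 x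
  let e : Fin (n + 1) → Fin n → ℝ := fun j k =>
    (if j = k.castSucc then 1 else 0) - (if j = Fin.last n then 1 else 0)
  have he (k : Fin n) : ∑ j, e j k = 0 := by simp [e]
  let v : X → Fin (n + 1) → EuclideanSpace ℝ (Fin n × Option (Fin d)) := fun x j =>
    WithLp.toLp 2 fun kc => e j kc.1 * hat x kc.2
  have h0 (x : X) : (0 : EuclideanSpace ℝ (Fin n × Option (Fin d))) ∈
      convexHull ℝ (Set.range (v x)) := by
    have : (0 : EuclideanSpace ℝ (Fin n × Option (Fin d))) =
        ∑ j, (1 / (n + 1 : ℝ)) • v x j := by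
      ext ⟨k, c⟩
      simp [v, ← Finset.mul_sum, ← Finset.sum_mul, he]
    rw [this]
    refine (convex_convexHull ℝ _).sum_mem (fun _ _ => by positivity) ?_
      fun j _ => subset_convexHull ℝ _ ⟨j, rfl⟩
    simp
    field_simp
  obtain ⟨s, hs⟩ := colorful_caratheodory
    (by simp only [finrank_euclideanSpace, Fintype.card_prod, Fintype.card_fin,
          Fintype.card_option, Fintype.card_coe]
        rw [mul_comm]; omega) v h0
  rw [convexHull_range_eq_exists_affineCombination] at hs
  obtain ⟨S, w, hw0, hw1, hw⟩ := hs
  rw [Finset.affineCombination_eq_linear_combination _ _ _ hw1] at hw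
  let T : Fin (n + 1) → Finset X := fun j => S.filter fun x => s x = j
  -- the lifted weighted sum of a class does not depend on the class
  have hsame (j : Fin (n + 1)) (c : Option (Fin d)) :
      ∑ x ∈ T j, w x * hat x c = ∑ x ∈ T (Fin.last n), w x * hat x c := by
    induction j using Fin.lastCases with
    | last => rfl
    | cast k =>
      have h := congrArg (fun u => u (k, c)) hw
      simp only [v, e, WithLp.ofLp_sum, WithLp.ofLp_smul, Finset.sum_apply, Pi.smul_apply,
        smul_eq_mul, WithLp.ofLp_zero, Pi.zero_apply, sub_mul, mul_sub, Finset.sum_sub_distrib,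
        ite_mul, mul_ite, one_mul, zero_mul, mul_zero, ← Finset.sum_filter] at h
      exact sub_eq_zero.1 h
  set ω := ∑ x ∈ T (Fin.last n), w x with hω
  have hωj (j) : ∑ x ∈ T j, w x = ω := by simpa [hat] using hsame j none
  have hωpos : ω ≠ 0 := by
    intro h
    have : ∑ j, ∑ x ∈ T j, w x = ∑ x ∈ S, w x := Finset.sum_fiberwise S s w
    simp [hωj, h, hw1] at this
  have hω0 : 0 ≤ ω := Finset.sum_nonneg fun x hx => hw0 x (Finset.mem_filter.1 hx).1
  refine ⟨∑ x ∈ T (Fin.last n), (w x / ω) • (x : EuclideanSpace ℝ (Fin d)),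
    fun x => if h : x ∈ X then s ⟨x, h⟩ else 0, fun j => ?_⟩
  have hp : ∑ x ∈ T (Fin.last n), (w x / ω) • (x : EuclideanSpace ℝ (Fin d)) =
      ∑ x ∈ T j, (w x / ω) • (x : EuclideanSpace ℝ (Fin d)) := by
    ext c
    have := hsame j (some c)
    simp only [hat, Option.elim] at this
    simp [div_mul_eq_mul_div, ← Finset.sum_div, this]
  rw [hp]
  refine (convex_convexHull ℝ _).sum_mem
    (fun x hx => div_nonneg (hw0 x (Finset.mem_filter.1 hx).1) hω0)
    (by rw [← Finset.sum_div, hωj, div_self hωpos]) fun x hx => subset_convexHull ℝ _ ?_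
  simp [(Finset.mem_filter.1 hx).2]

/-- Tverberg's theorem with the sizes of the parts bounded: Carathéodory's theorem shrinks the parts to
at most `d + 1` points each, and the points left over fit into the parts that are not full. -/
theorem exists_partition_of_card {d r : ℕ} (hr : 1 ≤ r)
    (X : Finset (EuclideanSpace ℝ (Fin d))) (hX_lower : (d + 1) * (r - 1) + 1 ≤ X.card)
    (hX_upper : X.card ≤ (d + 1) * r) :
    ∃ (p : EuclideanSpace ℝ (Fin d)) (P : Fin r → Finset (EuclideanSpace ℝ (Fin d))),
      (∀ i j, i ≠ j → Disjoint (P i) (P j)) ∧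
      (⋃ i, (P i : Set (EuclideanSpace ℝ (Fin d)))) = (X : Set (EuclideanSpace ℝ (Fin d))) ∧
      (∀ i, (P i).card ≤ d + 1) ∧
      ∀ i, p ∈ convexHull ℝ (P i : Set (EuclideanSpace ℝ (Fin d))) := by
  classical
  obtain ⟨p, s, hs⟩ := exists_common_point_of_card hr X hX_lower
  have hcar (j : Fin r) : ∃ t ⊆ X.filter (fun x => s x = j), t.card ≤ d + 1 ∧
      p ∈ convexHull ℝ (t : Set (EuclideanSpace ℝ (Fin d))) := by
    have h := hs j
    rw [convexHull_eq_union] at h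
    simp only [Set.mem_iUnion, Finset.coe_subset] at h
    obtain ⟨t, htX, hti, hpt⟩ := h
    refine ⟨t, htX, ?_, hpt⟩
    have := hti.card_le_finrank_succ.trans (Nat.succ_le_succ (Submodule.finrank_le _))
    simpa using this
  choose t htX htc hpt using hcar
  let valid : Set (Fin r → Finset (EuclideanSpace ℝ (Fin d))) :=
    {P | (∀ i j, i ≠ j → Disjoint (P i) (P j)) ∧ (∀ i, P i ⊆ X) ∧ (∀ i, (P i).card ≤ d + 1) ∧
      ∀ i, p ∈ convexHull ℝ (P i : Set (EuclideanSpace ℝ (Fin d)))}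
  have hfin : valid.Finite :=
    (Set.Finite.pi' fun _ : Fin r => (X.powerset : Finset _).finite_toSet).subset
      fun P hP i => by simpa using hP.2.1 i
  have hne : valid.Nonempty := by
    refine ⟨t, fun i j hij => Finset.disjoint_left.2 fun x hi hj => hij ?_,
      fun i => (htX i).trans (Finset.filter_subset _ _), htc, hpt⟩
    rw [← (Finset.mem_filter.1 (htX i hi)).2, (Finset.mem_filter.1 (htX j hj)).2]
  -- a family covering as many points as possible covers all of `X`
  obtain ⟨P, ⟨hdisj, hsub, hcard, hp⟩, hmax⟩ :=
    hfin.exists_maximalFor (fun P => ∑ i, (P i).card) _ hne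
  refine ⟨p, P, hdisj, Set.Subset.antisymm (Set.iUnion_subset fun i => by simpa using hsub i) ?_,
    hcard, hp⟩
  intro x hx
  by_contra hxP
  simp only [Set.mem_iUnion, Finset.mem_coe, not_exists] at hxP
  have hXx : Finset.univ.biUnion P ⊂ X := by
    refine Finset.ssubset_iff_subset_ne.2 ⟨Finset.biUnion_subset.2 fun i _ => hsub i, ?_⟩
    rintro rfl
    simp only [Finset.mem_coe, Finset.mem_biUnion] at hx
    obtain ⟨i, _, hi⟩ := hx
    exact hxP i hi
  have hlt := Finset.card_lt_card hXx
  rw [Finset.card_biUnion fun i _ j _ hij => hdisj i j hij] at hlt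
  obtain ⟨i, hi⟩ : ∃ i, (P i).card < d + 1 := by
    by_contra! h
    have : ∑ _i : Fin r, (d + 1) ≤ ∑ i, (P i).card := Finset.sum_le_sum fun i _ => h i
    simp only [Finset.sum_const, Finset.card_univ, Fintype.card_fin, smul_eq_mul] at this
    rw [mul_comm] at this
    omega
  have hle : P ≤ Function.update P i (insert x (P i)) := by
    intro j
    by_cases h : j = i
    · subst h; simp
    · simp [h]
  have hval : Function.update P i (insert x (P i)) ∈ valid := by
    refine ⟨fun j k hjk => ?_, fun j => ?_, fun j => ?_, fun j =>
      convexHull_mono (Finset.coe_subset.2 (hle j)) (hp j)⟩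
    · by_cases hj : j = i
      · subst hj
        rw [Function.update_self, Function.update_of_ne hjk.symm]
        exact Finset.disjoint_insert_left.2 ⟨hxP k, hdisj _ _ hjk⟩
      · by_cases hk : k = i
        · subst hk
          rw [Function.update_self, Function.update_of_ne hjk]
          exact Finset.disjoint_insert_right.2 ⟨hxP j, hdisj _ _ hjk⟩
        · rw [Function.update_of_ne hj, Function.update_of_ne hk]
          exact hdisj _ _ hjk
    · by_cases hj : j = i
      · subst hj
        rw [Function.update_self]
        exact Finset.insert_subset hx (hsub j)
      · rw [Function.update_of_ne hj]
        exact hsub j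
    · by_cases hj : j = i
      · subst hj
        rw [Function.update_self, Finset.card_insert_of_notMem (hxP j)]
        exact hi
      · rw [Function.update_of_ne hj]
        exact hcard j
  have hgt : ∑ j, (P j).card < ∑ j, (Function.update P i (insert x (P i)) j).card := by
    refine Finset.sum_lt_sum (fun j _ => Finset.card_le_card (hle j)) ⟨i, Finset.mem_univ i, ?_⟩
    rw [Function.update_self, Finset.card_insert_of_notMem (hxP i)]
    exact Nat.lt_succ_self _
  exact absurd (hmax hval hgt.le) (not_le.2 hgt)

/-! ### Splittings on which a mod 2 cocycle does not vanish -/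

/-- Let `f` be a mod 2 cocycle: it sums to zero over the `(m + 2)`-subsets of any `(m + 3)`-set. This
identity compares the splittings of `R ∪ {z, r}` into complementary `(m + 2)`-sets that separate `z`
from `r` with those that do not. It follows by expanding `f` through the cocycle relation twice. -/
theorem sum_cocycle_mul_eq {α : Type*} [DecidableEq α] {m : ℕ} (f : Finset α → ZMod 2)
    {R : Finset α} {z r : α} (hz : z ∉ R) (hr : r ∉ R) (hzr : z ≠ r)
    (hR : R.card = 2 * (m + 1))
    (hf : ∀ W ⊆ insert z (insert r R), W.card = m + 3 → ∑ u ∈ W, f (W.erase u) = 0) :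
    ∑ A ∈ R.powersetCard (m + 1), f (insert z A) * f (insert r (R \ A)) =
      ∑ D ∈ R.powersetCard m, f (insert z (insert r D)) * f (R \ D) := by
  have two_eq_zero : (2 : ZMod 2) = 0 := rfl
  have hexp : ∀ A ∈ R.powersetCard (m + 1),
      f (insert z A) = f (insert r A) + ∑ v ∈ A, f (insert z (insert r (A.erase v))) := by
    intro A hA
    obtain ⟨hAR, hAc⟩ := Finset.mem_powersetCard.1 hA
    have hzA : z ∉ A := fun h => hz (hAR h)
    have hrA : r ∉ A := fun h => hr (hAR h)
    have hzrA : z ∉ insert r A := by simp [hzr, hzA]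
    have h := hf (insert z (insert r A))
      (Finset.insert_subset_insert _ (Finset.insert_subset_insert _ hAR))
      (by rw [Finset.card_insert_of_notMem hzrA, Finset.card_insert_of_notMem hrA, hAc])
    rw [Finset.sum_insert hzrA, Finset.sum_insert hrA, Finset.erase_insert hzrA,
      Finset.erase_insert_of_ne hzr, Finset.erase_insert hrA] at h
    have h2 : ∑ v ∈ A, f ((insert z (insert r A)).erase v) =
        ∑ v ∈ A, f (insert z (insert r (A.erase v))) :=
      Finset.sum_congr rfl fun v hv => by
        rw [Finset.erase_insert_of_ne fun h : z = v => hzA (h ▸ hv),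
          Finset.erase_insert_of_ne fun h : r = v => hrA (h ▸ hv)]
    rw [h2] at h
    linear_combination h -
      (f (insert r A) + ∑ v ∈ A, f (insert z (insert r (A.erase v)))) * two_eq_zero
  have hcoexp : ∀ D ∈ R.powersetCard m,
      f (R \ D) = ∑ v ∈ R \ D, f (insert r ((R \ D).erase v)) := by
    intro D hD
    obtain ⟨hDR, hDc⟩ := Finset.mem_powersetCard.1 hD
    have hrD : r ∉ R \ D := fun h => hr (Finset.mem_sdiff.1 h).1
    have h := hf (insert r (R \ D))
      ((Finset.insert_subset_insert _ Finset.sdiff_subset).trans (Finset.subset_insert _ _))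
      (by rw [Finset.card_insert_of_notMem hrD, Finset.card_sdiff_of_subset hDR]; omega)
    have h2 : ∑ v ∈ R \ D, f ((insert r (R \ D)).erase v) =
        ∑ v ∈ R \ D, f (insert r ((R \ D).erase v)) :=
      Finset.sum_congr rfl fun v hv => by
        rw [Finset.erase_insert_of_ne fun h : r = v => hrD (h ▸ hv)]
    rw [Finset.sum_insert hrD, Finset.erase_insert hrD, h2] at h
    linear_combination h - (∑ v ∈ R \ D, f (insert r ((R \ D).erase v))) * two_eq_zero
  -- complementation in `R` pairs off the terms of this sum
  have hsymm : ∑ A ∈ R.powersetCard (m + 1), f (insert r A) * f (insert r (R \ A)) = 0 := by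
    refine Finset.sum_involution (fun A _ => R \ A) ?_ ?_ ?_ ?_
    · intro A hA
      rw [Finset.sdiff_sdiff_eq_self (Finset.mem_powersetCard.1 hA).1, mul_comm,
        CharTwo.add_self_eq_zero]
    · intro A hA _ h
      obtain ⟨hAR, hAc⟩ := Finset.mem_powersetCard.1 hA
      obtain ⟨a, ha⟩ := Finset.card_pos.1 (by omega : 0 < A.card)
      exact (Finset.mem_sdiff.1 (h.symm ▸ ha : a ∈ R \ A)).2 ha
    · intro A hA
      obtain ⟨hAR, hAc⟩ := Finset.mem_powersetCard.1 hA
      rw [Finset.mem_powersetCard, Finset.card_sdiff_of_subset hAR]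
      exact ⟨Finset.sdiff_subset, by omega⟩
    · intro A hA
      exact Finset.sdiff_sdiff_eq_self (Finset.mem_powersetCard.1 hA).1
  calc ∑ A ∈ R.powersetCard (m + 1), f (insert z A) * f (insert r (R \ A))
      = ∑ A ∈ R.powersetCard (m + 1), ∑ v ∈ A,
          f (insert z (insert r (A.erase v))) * f (insert r (R \ A)) := by
        rw [← zero_add (∑ A ∈ _, ∑ v ∈ _, _), ← hsymm, ← Finset.sum_add_distrib]
        refine Finset.sum_congr rfl fun A hA => ?_
        rw [hexp A hA, add_mul, Finset.sum_mul]
    _ = ∑ D ∈ R.powersetCard m, ∑ v ∈ R \ D,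
          f (insert z (insert r D)) * f (insert r ((R \ D).erase v)) := by
        rw [Finset.sum_sigma', Finset.sum_sigma']
        refine Finset.sum_bij' (fun x _ => ⟨x.1.erase x.2, x.2⟩)
          (fun x _ => ⟨insert x.2 x.1, x.2⟩) ?_ ?_ ?_ ?_ ?_
        · rintro ⟨A, v⟩ h
          simp only [Finset.mem_sigma, Finset.mem_powersetCard, Finset.mem_sdiff] at h ⊢
          obtain ⟨⟨h1, h2⟩, h3⟩ := h
          exact ⟨⟨(Finset.erase_subset _ _).trans h1, by rw [Finset.card_erase_of_mem h3]; omega⟩,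
            h1 h3, Finset.notMem_erase _ _⟩
        · rintro ⟨D, v⟩ h
          simp only [Finset.mem_sigma, Finset.mem_powersetCard, Finset.mem_sdiff] at h ⊢
          obtain ⟨⟨h1, h2⟩, h3, h4⟩ := h
          exact ⟨⟨Finset.insert_subset h3 h1, by rw [Finset.card_insert_of_notMem h4, h2]⟩,
            Finset.mem_insert_self _ _⟩
        · rintro ⟨A, v⟩ h
          simp only [Finset.mem_sigma] at h
          simp [Finset.insert_erase h.2]
        · rintro ⟨D, v⟩ h
          simp only [Finset.mem_sigma, Finset.mem_sdiff] at h
          simp [Finset.erase_insert h.2.2]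
        · rintro ⟨A, v⟩ h
          simp only [Finset.mem_sigma, Finset.mem_powersetCard] at h
          have : R \ A = (R \ A.erase v).erase v := by
            ext a
            simp only [Finset.mem_sdiff, Finset.mem_erase]
            have := h.2
            by_cases hav : a = v
            · subst hav; simp [this]
            · simp [hav]
          dsimp only
          rw [← this]
    _ = ∑ D ∈ R.powersetCard m, f (insert z (insert r D)) * f (R \ D) :=
        Finset.sum_congr rfl fun D hD => by rw [hcoexp D hD, Finset.mul_sum]

/-- For a mod 2 cocycle `f` on `(d + 1)`-sets, a splitting of a `(2d + 2)`-set into two halves on which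
`f` does not vanish is never unique, as the number of such splittings is even. -/
theorem exists_ne_of_cocycle {α : Type*} [DecidableEq α] {d : ℕ} (hd : 1 ≤ d)
    (f : Finset α → ZMod 2) {X Y : Finset α} (hXY : Disjoint X Y) (hX : X.card = d + 1)
    (hY : Y.card = d + 1)
    (hf : ∀ W ⊆ X ∪ Y, W.card = d + 2 → ∑ u ∈ W, f (W.erase u) = 0)
    (hfX : f X ≠ 0) (hfY : f Y ≠ 0) :
    ∃ A B : Finset α, Disjoint A B ∧ A ∪ B = X ∪ Y ∧ A.card = d + 1 ∧ B.card = d + 1 ∧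
      A ≠ X ∧ B ≠ X ∧ f A ≠ 0 ∧ f B ≠ 0 := by
  obtain ⟨m, rfl⟩ : ∃ m, d = m + 1 := ⟨d - 1, by omega⟩
  obtain ⟨z, hz⟩ := Finset.card_pos.1 (by omega : 0 < X.card)
  obtain ⟨r, hr⟩ := Finset.card_pos.1 (by omega : 0 < Y.card)
  have hzY : z ∉ Y := Finset.disjoint_left.1 hXY hz
  have hrX : r ∉ X := Finset.disjoint_right.1 hXY hr
  have hzr : z ≠ r := fun h => hzY (h ▸ hr)
  set X' := X.erase z with hX'
  set Y' := Y.erase r with hY'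
  have hXi : insert z X' = X := Finset.insert_erase hz
  have hYi : insert r Y' = Y := Finset.insert_erase hr
  have hdis : Disjoint X' Y' :=
    hXY.mono (Finset.erase_subset _ _) (Finset.erase_subset _ _)
  set R := X' ∪ Y' with hRdef
  have hXc : X'.card = m + 1 := by rw [hX', Finset.card_erase_of_mem hz]; omega
  have hYc : Y'.card = m + 1 := by rw [hY', Finset.card_erase_of_mem hr]; omega
  have hR : R.card = 2 * (m + 1) := by rw [hRdef, Finset.card_union_of_disjoint hdis]; omega
  have hzR : z ∉ R := by simp [hRdef, hX', hY', hzY]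
  have hrR : r ∉ R := by simp [hRdef, hX', hY', hrX]
  have hU : insert z (insert r R) = X ∪ Y := by
    rw [hRdef, ← Finset.union_insert, hYi, ← Finset.insert_union, hXi]
  have hRX : R \ X' = Y' := by rw [hRdef, Finset.union_sdiff_cancel_left hdis]
  have key := sum_cocycle_mul_eq f hzR hrR hzr hR (by rw [hU]; exact hf)
  by_contra! hcon
  have hright : ∑ D ∈ R.powersetCard m, f (insert z (insert r D)) * f (R \ D) = 0 := by
    refine Finset.sum_eq_zero fun D hD => ?_
    obtain ⟨hDR, hDc⟩ := Finset.mem_powersetCard.1 hD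
    have hrD : r ∉ D := fun h => hrR (hDR h)
    have hzD : z ∉ insert r D := by simp only [Finset.mem_insert, not_or]
                                    exact ⟨hzr, fun h => hzR (hDR h)⟩
    by_contra hne
    refine right_ne_zero_of_mul hne (hcon (insert z (insert r D)) (R \ D) ?_ ?_ ?_ ?_ ?_ ?_
      (left_ne_zero_of_mul hne))
    · simp [hzR, hrR, Finset.disjoint_sdiff]
    · rw [← hU, Finset.insert_union, Finset.insert_union, Finset.union_sdiff_of_subset hDR]
    · rw [Finset.card_insert_of_notMem hzD, Finset.card_insert_of_notMem hrD, hDc]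
    · rw [Finset.card_sdiff_of_subset hDR]; omega
    · intro h; exact hrX (h ▸ by simp)
    · intro h; exact (fun h' => hzR (Finset.mem_sdiff.1 h').1) (h ▸ hz)
  rw [hright, Finset.sum_eq_single X', hXi, hRX, hYi] at key
  · exact mul_ne_zero hfX hfY key
  · intro A hA hne
    obtain ⟨hAR, hAc⟩ := Finset.mem_powersetCard.1 hA
    have hzA : z ∉ A := fun h => hzR (hAR h)
    by_contra hne0
    refine right_ne_zero_of_mul hne0 (hcon (insert z A) (insert r (R \ A)) ?_ ?_ ?_ ?_ ?_ ?_
      (left_ne_zero_of_mul hne0))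
    · have : r ∉ A := fun h => hrR (hAR h)
      simp [hzR, this, hzr.symm, Finset.disjoint_sdiff]
    · rw [← hU, Finset.insert_union, Finset.union_insert, Finset.union_sdiff_of_subset hAR]
    · rw [Finset.card_insert_of_notMem hzA, hAc]
    · rw [Finset.card_insert_of_notMem (by simp [hrR]), Finset.card_sdiff_of_subset hAR]; omega
    · intro h; apply hne; rw [hX', ← h, Finset.erase_insert hzA]
    · intro h; have := h ▸ hz; simp [hzr, hzR] at this
  · intro h
    exact absurd (Finset.mem_powersetCard.2 ⟨Finset.subset_union_left, hXc⟩) h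

/-! ### Simplices containing a generic point -/

/-- Exchange step: if `q` is in the hull of `W` without `y`, then it is also in the hull of `W` without
some other point. An affine dependence of `W` is added to the weights of `q` until the weight of
another point vanishes. -/
theorem exists_mem_convexHull_insert_erase {E : Type*} [NormedAddCommGroup E] [NormedSpace ℝ E]
    [FiniteDimensional ℝ E] [DecidableEq E] {W : Finset E} {y q : E} (hy : y ∈ W)
    (hW : Module.finrank ℝ E + 1 < W.card) (hq : q ∈ convexHull ℝ (W.erase y : Set E)) :
    ∃ x ∈ W, x ≠ y ∧ q ∈ convexHull ℝ (W.erase x : Set E) := by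
  obtain ⟨a, ha0, ha1, haq⟩ := Finset.mem_convexHull'.1 hq
  obtain ⟨c, hc0, hc1, u, huW, hu⟩ :=
    Module.exists_nontrivial_relation_sum_zero_of_finrank_succ_lt_card hW
  -- up to sign, the affine dependence is nonpositive at `y`
  obtain ⟨c, hc0, hc1, hcy, u, huW, hu⟩ : ∃ c : E → ℝ, ∑ e ∈ W, c e • e = 0 ∧ ∑ e ∈ W, c e = 0 ∧
      c y ≤ 0 ∧ ∃ x ∈ W, c x ≠ 0 := by
    rcases le_total (c y) 0 with h | h
    · exact ⟨c, hc0, hc1, h, u, huW, hu⟩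
    · exact ⟨-c, by simp [hc0], by simp [hc1], by simpa using h, u, huW, by simpa using hu⟩
  have hpos : (W.filter fun x => 0 < c x).Nonempty := by
    by_contra hne
    rw [Finset.not_nonempty_iff_eq_empty, Finset.filter_eq_empty_iff] at hne
    exact hu ((Finset.sum_eq_zero_iff_of_nonpos fun x hx => not_lt.1 (hne hx)).1 hc1 u huW)
  obtain ⟨x, hx, hmin⟩ := Finset.exists_min_image _ (fun x => a x / c x) hpos
  obtain ⟨hxW, hcx⟩ := Finset.mem_filter.1 hx
  have hxy : x ≠ y := by rintro rfl; linarith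
  have hax : 0 ≤ a x := ha0 x (Finset.mem_erase.2 ⟨hxy, hxW⟩)
  set t := a x / c x with ht
  have ht0 : 0 ≤ t := div_nonneg hax hcx.le
  have htx : t * c x = a x := div_mul_cancel₀ _ hcx.ne'
  set a' : E → ℝ := Function.update a y 0 with ha'
  have ha'y : a' y = 0 := Function.update_self ..
  have ha'n {e} (h : e ≠ y) : a' e = a e := Function.update_of_ne h ..
  have hs1 : ∑ e ∈ W, a' e = 1 := by
    rw [← Finset.add_sum_erase _ _ hy, ha'y, zero_add, ← ha1]
    exact Finset.sum_congr rfl fun e he => ha'n (Finset.ne_of_mem_erase he)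
  have hs2 : ∑ e ∈ W, a' e • e = q := by
    rw [← Finset.add_sum_erase _ _ hy, ha'y, zero_smul, zero_add, ← haq]
    exact Finset.sum_congr rfl fun e he => by rw [ha'n (Finset.ne_of_mem_erase he)]
  have hbx : a' x - t * c x = 0 := by rw [ha'n hxy, htx, sub_self]
  refine ⟨x, hxW, hxy, Finset.mem_convexHull'.2 ⟨fun e => a' e - t * c e, ?_, ?_, ?_⟩⟩
  · intro e he
    have heW := Finset.mem_of_mem_erase he
    change 0 ≤ a' e - t * c e
    by_cases hey : e = y
    · subst hey
      rw [ha'y]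
      nlinarith
    · rw [ha'n hey]
      have hae := ha0 e (Finset.mem_erase.2 ⟨hey, heW⟩)
      rcases le_or_gt (c e) 0 with h | h
      · nlinarith
      · have := hmin e (Finset.mem_filter.2 ⟨heW, h⟩)
        rw [le_div_iff₀ h] at this
        linarith
  · have : ∑ e ∈ W, (a' e - t * c e) = 1 := by
      rw [Finset.sum_sub_distrib, ← Finset.mul_sum, hs1, hc1]; ring
    rwa [← Finset.add_sum_erase _ _ hxW, hbx, zero_add] at this
  · have : ∑ e ∈ W, (a' e - t * c e) • e = q := by
      simp only [sub_smul, mul_smul, Finset.sum_sub_distrib, ← Finset.smul_sum, hs2, hc0]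
      simp
    rwa [← Finset.add_sum_erase _ _ hxW, hbx, zero_smul, zero_add] at this

theorem mem_affineSpan_of_sum {E : Type*} [NormedAddCommGroup E] [NormedSpace ℝ E]
    {D : Finset E} {η : E → ℝ} {q : E} (h1 : ∑ w ∈ D, η w = 1) (hq : ∑ w ∈ D, η w • w = q) :
    q ∈ affineSpan ℝ (D : Set E) := by
  have h := affineCombination_mem_affineSpan (s := D.attach) (w := fun w => η w)
    (by rwa [Finset.sum_attach D η]) (fun w : D => (w : E))
  rw [Finset.affineCombination_eq_linear_combination _ _ _ (by rwa [Finset.sum_attach D η]),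
    Finset.sum_attach D fun w => η w • w, hq] at h
  simpa using h

/-- If `q` is on no affine span of `finrank E` points of a set `W` of `finrank E + 2` points, then `q`
lies in an even number (in fact `0` or `2`) of the simplices spanned by `W` with one point removed.
Nothing is assumed about the position of the points of `W` among themselves. -/
theorem even_card_mem_convexHull_erase {E : Type*} [NormedAddCommGroup E] [NormedSpace ℝ E]
    [FiniteDimensional ℝ E] [DecidableEq E] {W : Finset E} {q : E}
    [DecidablePred fun u => q ∈ convexHull ℝ (W.erase u : Set E)]
    (hW : W.card = Module.finrank ℝ E + 2)
    (hgen : ∀ D ⊆ W, D.card = Module.finrank ℝ E → q ∉ affineSpan ℝ (D : Set E)) :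
    Even (W.filter fun u => q ∈ convexHull ℝ (W.erase u : Set E)).card := by
  -- an affine combination equal to `q` cannot vanish at two points of `W`
  have hno (η : E → ℝ) (u v : E) (hu : u ∈ W) (hv : v ∈ W) (huv : u ≠ v) (hηu : η u = 0)
      (hηv : η v = 0) (h1 : ∑ w ∈ W, η w = 1) : ∑ w ∈ W, η w • w ≠ q := by
    intro hq
    have hv' : v ∈ W.erase u := Finset.mem_erase.2 ⟨huv.symm, hv⟩
    refine hgen ((W.erase u).erase v)
      ((Finset.erase_subset _ _).trans (Finset.erase_subset _ _))
      (by rw [Finset.card_erase_of_mem hv', Finset.card_erase_of_mem hu, hW]; rfl)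
      (mem_affineSpan_of_sum (η := η) ?_ ?_)
    · rwa [← Finset.add_sum_erase _ _ hu, ← Finset.add_sum_erase _ _ hv', hηu, hηv, zero_add,
        zero_add] at h1
    · rwa [← Finset.add_sum_erase _ _ hu, ← Finset.add_sum_erase _ _ hv', hηu, hηv, zero_smul,
        zero_smul, zero_add, zero_add] at hq
  have hrep (u : E) (hu : u ∈ W) (h : q ∈ convexHull ℝ (W.erase u : Set E)) :
      ∃ a : E → ℝ, a u = 0 ∧ (∀ w ∈ W, w ≠ u → 0 < a w) ∧ ∑ w ∈ W, a w = 1 ∧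
        ∑ w ∈ W, a w • w = q := by
    obtain ⟨a, ha0, ha1, haq⟩ := Finset.mem_convexHull'.1 h
    have hn {w} (h : w ≠ u) : Function.update a u 0 w = a w := Function.update_of_ne h ..
    have hs1 : ∑ w ∈ W, Function.update a u 0 w = 1 := by
      rw [← Finset.add_sum_erase _ _ hu, Function.update_self, zero_add, ← ha1]
      exact Finset.sum_congr rfl fun w hw => hn (Finset.ne_of_mem_erase hw)
    have hs2 : ∑ w ∈ W, Function.update a u 0 w • w = q := by
      rw [← Finset.add_sum_erase _ _ hu, Function.update_self, zero_smul, zero_add, ← haq]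
      exact Finset.sum_congr rfl fun w hw => by rw [hn (Finset.ne_of_mem_erase hw)]
    refine ⟨Function.update a u 0, Function.update_self .., fun w hw hwu => ?_, hs1, hs2⟩
    refine lt_of_le_of_ne ?_ fun h0 => ?_
    · rw [hn hwu]; exact ha0 w (Finset.mem_erase.2 ⟨hwu, hw⟩)
    · exact hno _ u w hu hw hwu.symm (Function.update_self ..) h0.symm hs1 hs2
  by_cases hemp : (W.filter fun u => q ∈ convexHull ℝ (W.erase u : Set E)) = ∅
  · simp [hemp]
  obtain ⟨y, hyf⟩ := Finset.nonempty_iff_ne_empty.2 hemp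
  obtain ⟨hy, hqy⟩ := Finset.mem_filter.1 hyf
  obtain ⟨x, hx, hxy, hqx⟩ := exists_mem_convexHull_insert_erase hy (by omega) hqy
  suffices h : (W.filter fun u => q ∈ convexHull ℝ (W.erase u : Set E)) = {x, y} by
    rw [h, Finset.card_pair hxy]; exact even_two
  ext z
  simp only [Finset.mem_filter, Finset.mem_insert, Finset.mem_singleton]
  constructor
  swap
  · rintro (rfl | rfl)
    exacts [⟨hx, hqx⟩, ⟨hy, hqy⟩]
  rintro ⟨hz, hqz⟩
  by_contra! hne
  obtain ⟨hzx, hzy⟩ := hne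
  obtain ⟨a, hay, hapos, ha1, haq⟩ := hrep y hy hqy
  obtain ⟨b, hbx, hbpos, hb1, hbq⟩ := hrep x hx hqx
  obtain ⟨c, hcz, hcpos, hc1, hcq⟩ := hrep z hz hqz
  -- `δ = c - t b - s a` vanishes at `x` and `y` and is negative at `z`
  set t := c y / b y with ht
  set s := c x / a x with hs
  have htpos : 0 < t := div_pos (hcpos y hy hzy.symm) (hbpos y hy hxy.symm)
  have hspos : 0 < s := div_pos (hcpos x hx hzx.symm) (hapos x hx hxy)
  set δ : E → ℝ := fun w => c w - t * b w - s * a w with hδ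
  have hδx : δ x = 0 := by
    simp only [hδ, hbx, hs, div_mul_cancel₀ _ (hapos x hx hxy).ne']; ring
  have hδy : δ y = 0 := by
    simp only [hδ, hay, ht, div_mul_cancel₀ _ (hbpos y hy hxy.symm).ne']; ring
  have hδz : δ z < 0 := by
    have h1 := mul_pos htpos (hbpos z hz hzx)
    have h2 := mul_pos hspos (hapos z hz hzy)
    simp only [hδ, hcz]; linarith
  have hδ1 : ∑ w ∈ W, δ w = 1 - t - s := by
    simp only [hδ, Finset.sum_sub_distrib, ← Finset.mul_sum, ha1, hb1, hc1]; ring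
  have hδq : ∑ w ∈ W, δ w • w = (1 - t - s) • q := by
    simp only [hδ, sub_smul, mul_smul, Finset.sum_sub_distrib, ← Finset.smul_sum, haq, hbq, hcq,
      one_smul]
  by_cases h0 : 1 - t - s = 0
  · -- here `δ` is an affine dependence, used to cancel the coefficient of `a` at `z`
    have hcancel : a z - a z / δ z * δ z = 0 := by
      rw [div_mul_cancel₀ _ hδz.ne, sub_self]
    refine hno (fun w => a w - a z / δ z * δ w) y z hy hz hzy.symm ?_ hcancel ?_ ?_
    · simp [hay, hδy]
    · rw [Finset.sum_sub_distrib, ← Finset.mul_sum, hδ1, h0, ha1]; ring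
    · simp only [sub_smul, mul_smul, Finset.sum_sub_distrib, ← Finset.smul_sum, hδq, h0, haq]
      simp
  · refine hno (fun w => (1 - t - s)⁻¹ * δ w) x y hx hy hxy (by simp [hδx]) (by simp [hδy]) ?_ ?_
    · rw [← Finset.mul_sum, hδ1, inv_mul_cancel₀ h0]
    · simp only [mul_smul, ← Finset.smul_sum, hδq]
      rw [smul_smul, inv_mul_cancel₀ h0, one_smul]

/-! ### Repartitioning two simplices with a common point -/

theorem exists_mem_convexHull_erase_of_notMem_interior {E : Type*} [NormedAddCommGroup E]
    [NormedSpace ℝ E] [FiniteDimensional ℝ E] [DecidableEq E] {Y : Finset E} {p : E}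
    (hY : Y.card = Module.finrank ℝ E + 1) (hp : p ∈ convexHull ℝ (Y : Set E))
    (hpi : p ∉ interior (convexHull ℝ (Y : Set E))) :
    ∃ y ∈ Y, p ∈ convexHull ℝ (Y.erase y : Set E) := by
  have h := hp
  rw [convexHull_eq_union] at h
  simp only [Set.mem_iUnion, Finset.coe_subset] at h
  obtain ⟨t, htY, hti, hpt⟩ := h
  by_cases htY' : t = Y
  swap
  · obtain ⟨y, hyY, hyt⟩ := Finset.exists_of_ssubset (htY.ssubset_of_ne htY')
    refine ⟨y, hyY, convexHull_mono ?_ hpt⟩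
    exact_mod_cast Finset.subset_erase.2 ⟨htY, hyt⟩
  subst htY'
  obtain ⟨a, ha0, ha1, hap⟩ := Finset.mem_convexHull'.1 hp
  by_contra! hcon
  apply hpi
  let b : AffineBasis t ℝ E := ⟨(↑), hti, by
    have := hti.affineSpan_eq_top_iff_card_eq_finrank_add_one.2 (by simpa using hY)
    exact this⟩
  have hb : Set.range b = (t : Set E) := Subtype.range_coe
  rw [← hb, b.interior_convexHull]
  have hap' : Finset.univ.affineCombination ℝ b (fun e : t => a e) = p := by
    have h1 : ∑ e : t, a e = 1 := by rw [← ha1]; exact Finset.sum_coe_sort t a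
    rw [Finset.affineCombination_eq_linear_combination _ _ _ h1, ← hap]
    exact Finset.sum_coe_sort t fun e => a e • e
  intro e
  have hcoord : b.coord e p = a e := by
    rw [← hap']
    exact b.coord_apply_combination_of_mem (Finset.mem_univ e)
      (by rw [← ha1]; exact Finset.sum_coe_sort t a)
  rw [hcoord]
  refine lt_of_le_of_ne (ha0 e e.2) fun h0 => hcon e e.2 (Finset.mem_convexHull'.2 ⟨a, ?_, ?_, ?_⟩)
  · exact fun y hy => ha0 y (Finset.mem_of_mem_erase hy)
  · rwa [← Finset.add_sum_erase _ _ e.2, ← h0, zero_add] at ha1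
  · rwa [← Finset.add_sum_erase _ _ e.2, ← h0, zero_smul, zero_add] at hap

/-- Generic points avoid the affine spans of `d` points, which are proper and hence null sets. -/
theorem dense_setOf_notMem_affineSpan {d : ℕ} (Z : Finset (EuclideanSpace ℝ (Fin d))) :
    Dense {q : EuclideanSpace ℝ (Fin d) |
      ∀ D ⊆ Z, D.card = d → q ∉ affineSpan ℝ (D : Set (EuclideanSpace ℝ (Fin d)))} := by
  apply MeasureTheory.Measure.dense_of_ae (μ := MeasureTheory.volume)
  have h : ∀ D ∈ Z.powerset, ∀ᵐ q : EuclideanSpace ℝ (Fin d), D.card = d →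
      q ∉ affineSpan ℝ (D : Set (EuclideanSpace ℝ (Fin d))) := by
    intro D _
    by_cases hD : D.card = d
    · have htop : affineSpan ℝ (D : Set (EuclideanSpace ℝ (Fin d))) ≠ ⊤ := by
        intro h
        have h1 := AffineSubspace.direction_top ℝ (EuclideanSpace ℝ (Fin d))
          (EuclideanSpace ℝ (Fin d))
        rw [← h, direction_affineSpan] at h1
        rcases D.eq_empty_or_nonempty with rfl | hne
        · rw [Finset.coe_empty, AffineSubspace.span_empty] at h
          exact AffineSubspace.bot_ne_top _ _ _ h
        · have h2 := finrank_vectorSpan_range_le ℝ (fun e : D => (e : EuclideanSpace ℝ (Fin d)))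
            (n := d - 1) (by have := hne.card_pos; simp; omega)
          rw [Subtype.range_coe_subtype] at h2
          change Module.finrank ℝ (vectorSpan ℝ (D : Set (EuclideanSpace ℝ (Fin d)))) ≤ _ at h2
          rw [h1, finrank_top, finrank_euclideanSpace_fin] at h2
          have := hne.card_pos
          omega
      filter_upwards [MeasureTheory.measure_eq_zero_iff_ae_notMem.1
        (MeasureTheory.Measure.addHaar_affineSubspace MeasureTheory.volume _ htop)]
        with q hq _ using hq
    · exact .of_forall fun q h => absurd h hD
  have := (Filter.eventually_all_finset Z.powerset).2 h
  filter_upwards [this] with q hq D hD using hq D (Finset.mem_powerset.2 hD)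

/-- If `p` is interior to the hull of `X` and lies in the hull of `Y`, the union of these disjoint sets
of `d + 1` points has another splitting into halves with `p` in both hulls. If `p` is interior to
both hulls, move `p` to a generic nearby point `q`; then `q ∈ convexHull A` is
a mod 2 cocycle in `A`, and every solution for `q` is one for `p`. Otherwise `p` does not need some
point of `Y`, which can be exchanged with a point of `X`. -/
theorem exists_repartition {d : ℕ} (hd : 1 ≤ d) [DecidableEq (EuclideanSpace ℝ (Fin d))]
    {X Y : Finset (EuclideanSpace ℝ (Fin d))}
    (hXY : Disjoint X Y) (hX : X.card = d + 1) (hY : Y.card = d + 1)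
    {p : EuclideanSpace ℝ (Fin d)}
    (hpX : p ∈ interior (convexHull ℝ (X : Set (EuclideanSpace ℝ (Fin d)))))
    (hpY : p ∈ convexHull ℝ (Y : Set (EuclideanSpace ℝ (Fin d)))) :
    ∃ A B : Finset (EuclideanSpace ℝ (Fin d)), Disjoint A B ∧ A ∪ B = X ∪ Y ∧
      A.card = d + 1 ∧ B.card = d + 1 ∧ A ≠ X ∧ B ≠ X ∧
      p ∈ convexHull ℝ (A : Set (EuclideanSpace ℝ (Fin d))) ∧
      p ∈ convexHull ℝ (B : Set (EuclideanSpace ℝ (Fin d))) := by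
  classical
  have hfr : Module.finrank ℝ (EuclideanSpace ℝ (Fin d)) = d := finrank_euclideanSpace_fin
  by_cases hpYi : p ∈ interior (convexHull ℝ (Y : Set (EuclideanSpace ℝ (Fin d))))
  · let H : Finset (EuclideanSpace ℝ (Fin d)) → Set (EuclideanSpace ℝ (Fin d)) :=
      fun A => convexHull ℝ (A : Set (EuclideanSpace ℝ (Fin d)))
    have hclosed (A) : IsClosed (H A) := (A.finite_toSet.isCompact_convexHull ℝ).isClosed
    let U := ⋂ A ∈ (X ∪ Y).powerset.filter fun A => p ∉ H A, (H A)ᶜ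
    have hU : IsOpen U := isOpen_biInter_finset fun A _ => (hclosed A).isOpen_compl
    obtain ⟨q, ⟨⟨hqX, hqY⟩, hqU⟩, hgen⟩ :=
      (dense_setOf_notMem_affineSpan (X ∪ Y)).inter_open_nonempty
        (interior (H X) ∩ interior (H Y) ∩ U)
        ((isOpen_interior.inter isOpen_interior).inter hU)
        ⟨p, ⟨hpX, hpYi⟩, by
          simp only [U, Set.mem_iInter]
          exact fun A hA => (Finset.mem_filter.1 hA).2⟩
    have hback {A} (hA : A ⊆ X ∪ Y) (hq : q ∈ H A) : p ∈ H A := by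
      by_contra hp
      simp only [U, Set.mem_iInter] at hqU
      exact hqU A (Finset.mem_filter.2 ⟨Finset.mem_powerset.2 hA, hp⟩) hq
    have hcocycle : ∀ W ⊆ X ∪ Y, W.card = d + 2 →
        ∑ u ∈ W, (if q ∈ H (W.erase u) then 1 else 0 : ZMod 2) = 0 := by
      intro W hW hWc
      have := even_card_mem_convexHull_erase (W := W) (q := q) (by rw [hfr, hWc])
        (by rw [hfr]; exact fun D hD => hgen D (hD.trans hW))
      rw [Finset.sum_boole]
      exact ZMod.natCast_eq_zero_iff_even.2 this
    obtain ⟨A, B, hAB, hU', hA, hB, hAX, hBX, hfA, hfB⟩ := exists_ne_of_cocycle hd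
      (fun A => if q ∈ H A then 1 else 0) hXY hX hY hcocycle
      (by simp [interior_subset hqX]) (by simp [interior_subset hqY])
    exact ⟨A, B, hAB, hU', hA, hB, hAX, hBX,
      hback (hU' ▸ Finset.subset_union_left) (by simpa using hfA),
      hback (hU' ▸ Finset.subset_union_right) (by simpa using hfB)⟩
  · obtain ⟨y, hy, hpy⟩ :=
      exists_mem_convexHull_erase_of_notMem_interior (by rw [hfr, hY]) hpY hpYi
    have hyX : y ∉ X := Finset.disjoint_right.1 hXY hy
    obtain ⟨x, hx, hxy, hpx⟩ := exists_mem_convexHull_insert_erase (W := insert y X) (y := y)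
      (q := p) (Finset.mem_insert_self _ _)
      (by rw [hfr, Finset.card_insert_of_notMem hyX, hX]; omega)
      (by rw [Finset.erase_insert hyX]; exact interior_subset hpX)
    have hxX : x ∈ X := (Finset.mem_insert.1 hx).resolve_left hxy
    have hxY : x ∉ Y := Finset.disjoint_left.1 hXY hxX
    have hxY' : x ∉ Y.erase y := fun h => hxY (Finset.mem_of_mem_erase h)
    have hYc : (Y.erase y).card = d := by rw [Finset.card_erase_of_mem hy, hY]; rfl
    refine ⟨(insert y X).erase x, insert x (Y.erase y), ?_, ?_, ?_, ?_, ?_, ?_, hpx,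
      convexHull_mono (by simp) hpy⟩
    · rw [Finset.disjoint_insert_right]
      refine ⟨Finset.notMem_erase _ _, Finset.disjoint_left.2 fun e he he' => ?_⟩
      obtain ⟨hey, heY⟩ := Finset.mem_erase.1 he'
      exact Finset.disjoint_right.1 hXY heY
        ((Finset.mem_insert.1 (Finset.mem_of_mem_erase he)).resolve_left hey)
    · ext e
      by_cases h1 : e = x <;> by_cases h2 : e = y <;> simp_all
    · rw [Finset.card_erase_of_mem hx, Finset.card_insert_of_notMem hyX, hX]; rfl
    · rw [Finset.card_insert_of_notMem hxY', hYc]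
    · intro h
      exact hyX (h ▸ Finset.mem_erase.2 ⟨hxy.symm, Finset.mem_insert_self _ _⟩)
    · intro h
      obtain ⟨e, he⟩ := Finset.card_pos.1 (by omega : 0 < (Y.erase y).card)
      exact Finset.disjoint_right.1 hXY (Finset.mem_of_mem_erase he)
        (h ▸ Finset.mem_insert_of_mem he)

/-! ### Convex bodies with disjoint frontiers -/

/-- A preconnected set meeting a closed set `L` but not its frontier stays in the interior of `L`. -/
theorem subset_interior_of_frontier_inter_eq_empty {E : Type*} [NormedAddCommGroup E]
    {K L : Set E} (hK : IsPreconnected K) (hL : IsClosed L) {p : E} (hpK : p ∈ K)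
    (hpL : p ∈ L) (h : K ∩ frontier L = ∅) : K ⊆ interior L := by
  have hsplit : K ⊆ interior L ∪ Lᶜ := by
    intro x hx
    by_cases hxL : x ∈ L
    · left
      by_contra hxi
      have : x ∈ K ∩ frontier L := ⟨hx, subset_closure hxL, hxi⟩
      rw [h] at this
      exact this
    · exact Or.inr hxL
  have hp : p ∈ interior L := (hsplit hpK).resolve_right fun h => h hpL
  exact hK.subset_left_of_subset_union isOpen_interior hL.isOpen_compl
    (Set.disjoint_left.2 fun x h1 h2 => h2 (interior_subset h1)) hsplit ⟨p, hpK, hp⟩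

theorem isPreconnected_frontier_of_convex {E : Type*} [NormedAddCommGroup E] [NormedSpace ℝ E]
    (hE : 1 < Module.rank ℝ E) {L : Set E} (hL : Convex ℝ L) (hc : Bornology.IsBounded L)
    (hi : (interior L).Nonempty) : IsPreconnected (frontier L) := by
  obtain ⟨h, -, -, hf⟩ := exists_homeomorph_image_interior_closure_frontier_eq_unitBall hL hi hc
  rw [← h.isPreconnected_image, hf]
  exact isPreconnected_sphere hE 0 1

/-- A compact set whose frontier lies in the interior of a convex set lies there entirely, since each of
its points is on a segment between two frontier points. -/
theorem subset_interior_of_frontier_subset {E : Type*} [NormedAddCommGroup E] [NormedSpace ℝ E]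
    [Nontrivial E] {K L : Set E} (hK : Convex ℝ K) (hL : IsCompact L)
    (h : frontier L ⊆ interior K) : L ⊆ interior K := by
  intro x hx
  by_cases hxf : x ∈ frontier L
  · exact h hxf
  obtain ⟨u, hu⟩ := exists_ne (0 : E)
  -- every ray from a point of `L` meets the frontier of `L`
  have hray (v : E) (hv : v ≠ 0) : ∃ t : ℝ, 0 ≤ t ∧ x + t • v ∈ frontier L := by
    by_contra! hcon
    have hpre : IsPreconnected ((fun t : ℝ => x + t • v) '' Set.Ici 0) :=
      isPreconnected_Ici.image _ (by fun_prop)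
    have hsub := subset_interior_of_frontier_inter_eq_empty hpre hL.isClosed
      (p := x) ⟨0, by simp, by simp⟩ hx (by
        rw [Set.eq_empty_iff_forall_notMem]
        rintro _ ⟨⟨t, ht, rfl⟩, hf⟩
        exact hcon t ht hf)
    obtain ⟨R, hR⟩ := hL.isBounded.exists_norm_le
    have hv' : 0 < ‖v‖ := norm_pos_iff.2 hv
    have hR0 : 0 ≤ R := (norm_nonneg x).trans (hR x hx)
    set t : ℝ := (2 * R + 1) / ‖v‖ with ht
    have ht0 : 0 ≤ t := by positivity
    have h1 := hR _ (interior_subset (hsub ⟨t, ht0, rfl⟩))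
    have h2 : ‖t • v‖ = 2 * R + 1 := by
      rw [norm_smul, Real.norm_of_nonneg ht0, ht, div_mul_cancel₀ _ hv'.ne']
    have h3 : ‖t • v‖ ≤ ‖x + t • v‖ + ‖x‖ := by
      simpa using norm_sub_le (x + t • v) x
    have := hR x hx
    simp only at h1
    linarith
  obtain ⟨s, hs, hsf⟩ := hray u hu
  obtain ⟨t, ht, htf⟩ := hray (-u) (neg_ne_zero.2 hu)
  have hs' : 0 < s := lt_of_le_of_ne hs fun h0 => hxf (by simpa [← h0] using hsf)
  have ht' : 0 < t := lt_of_le_of_ne ht fun h0 => hxf (by simpa [← h0] using htf)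
  have hcomb := hK.interior (h hsf) (h htf) (a := t / (s + t)) (b := s / (s + t))
    (by positivity) (by positivity) (by field_simp; ring)
  convert hcomb using 1
  have : t / (s + t) + s / (s + t) = 1 := by field_simp; ring
  calc x = (t / (s + t) + s / (s + t)) • x + (t / (s + t) * s - s / (s + t) * t) • u := by
        rw [this]; simp only [one_smul]
        rw [show t / (s + t) * s - s / (s + t) * t = 0 by ring]; simp
    _ = _ := by module

/-- In dimension at least two, intersecting convex bodies with disjoint frontiers are nested. Dimension
two is needed for the frontier of a convex body to be connected. -/
theorem nested_of_frontier_inter_eq_empty {E : Type*} [NormedAddCommGroup E] [NormedSpace ℝ E]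
    (hE : 1 < Module.rank ℝ E) {K L : Set E} (hK : Convex ℝ K) (hL : Convex ℝ L)
    (hKc : IsCompact K) (hLc : IsCompact L) {p : E} (hpK : p ∈ K) (hpL : p ∈ L)
    (h : frontier K ∩ frontier L = ∅) : K ⊆ interior L ∨ L ⊆ interior K := by
  have hnt : Nontrivial E := rank_pos_iff_nontrivial.1 (zero_lt_one.trans hE)
  have hnot {x} (h1 : x ∈ frontier K) (h2 : x ∈ frontier L) : False := by
    have : x ∈ frontier K ∩ frontier L := ⟨h1, h2⟩
    rw [h] at this
    exact this
  by_contra! hcon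
  obtain ⟨hKL, hLK⟩ := hcon
  obtain ⟨a, haK, haL⟩ : (K ∩ frontier L).Nonempty := by
    rw [Set.nonempty_iff_ne_empty]
    exact fun h0 => hKL
      (subset_interior_of_frontier_inter_eq_empty hK.isPreconnected hLc.isClosed hpK hpL h0)
  obtain ⟨b, hbL, hbK⟩ : (L ∩ frontier K).Nonempty := by
    rw [Set.nonempty_iff_ne_empty]
    exact fun h0 => hLK
      (subset_interior_of_frontier_inter_eq_empty hL.isPreconnected hKc.isClosed hpL hpK h0)
  have hbi : b ∈ interior L := by
    by_contra hbi
    exact hnot hbK ⟨subset_closure hbL, hbi⟩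
  refine hLK (subset_interior_of_frontier_subset hK hLc ?_)
  refine subset_interior_of_frontier_inter_eq_empty
    (isPreconnected_frontier_of_convex hE hL hLc.isBounded ⟨b, hbi⟩) hKc.isClosed haL haK ?_
  rw [Set.inter_comm]
  exact h

/-! ### Decreasing the potential -/

/-- Each vertex of a simplex is an extreme point, so a set `A` of `d + 1` points of the simplex `X` and
its interior that is not `X` itself has a hull that misses some vertex of `X`. -/
theorem exists_mem_notMem_convexHull {d : ℕ} (hd : 1 ≤ d)
    {X Y A : Finset (EuclideanSpace ℝ (Fin d))} (hX : X.card = d + 1)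
    (hYX : (Y : Set (EuclideanSpace ℝ (Fin d))) ⊆
      interior (convexHull ℝ (X : Set (EuclideanSpace ℝ (Fin d)))))
    (hi : (interior (convexHull ℝ (X : Set (EuclideanSpace ℝ (Fin d))))).Nonempty)
    (hA : (A : Set (EuclideanSpace ℝ (Fin d))) ⊆ X ∪ Y)
    (hAc : A.card = d + 1) (hAX : A ≠ X) :
    ∃ x ∈ X, x ∉ convexHull ℝ (A : Set (EuclideanSpace ℝ (Fin d))) := by
  classical
  have htop := interior_convexHull_nonempty_iff_affineSpan_eq_top.1 hi
  have hai : AffineIndependent ℝ ((↑) : X → EuclideanSpace ℝ (Fin d)) := by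
    rw [affineIndependent_iff_finrank_vectorSpan_eq ℝ _ (n := d) (by simpa using hX)]
    have h1 : vectorSpan ℝ (X : Set (EuclideanSpace ℝ (Fin d))) = ⊤ := by
      rw [← direction_affineSpan, htop, AffineSubspace.direction_top]
    have h2 : Set.range ((↑) : X → EuclideanSpace ℝ (Fin d)) = (X : Set _) := Subtype.range_coe
    rw [h2, h1, finrank_top, finrank_euclideanSpace_fin]
  let b : AffineBasis X ℝ (EuclideanSpace ℝ (Fin d)) := ⟨(↑), hai, by
    have h2 : Set.range ((↑) : X → EuclideanSpace ℝ (Fin d)) = (X : Set _) := Subtype.range_coe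
    rw [h2, htop]⟩
  have hb : Set.range b = (X : Set (EuclideanSpace ℝ (Fin d))) := Subtype.range_coe
  obtain ⟨x, hxX, hxA⟩ : ∃ x ∈ X, x ∉ A := by
    by_contra! h
    exact hAX (Finset.eq_of_subset_of_card_le h (by omega)).symm
  refine ⟨x, hxX, fun hx => ?_⟩
  -- the barycentric coordinate of `x` is less than `1` on `A`, hence on its convex hull
  have hlt : convexHull ℝ (A : Set (EuclideanSpace ℝ (Fin d))) ⊆
      {e | b.coord ⟨x, hxX⟩ e < 1} := by
    refine convexHull_min (fun e he => ?_) ((convex_Iio (1 : ℝ)).affine_preimage (b.coord ⟨x, hxX⟩))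
    rcases hA he with heX | heY
    · have hne : (⟨x, hxX⟩ : X) ≠ ⟨e, heX⟩ := by
        intro h
        exact hxA (by rw [Subtype.mk.inj h]; exact he)
      have : b.coord ⟨x, hxX⟩ (b ⟨e, heX⟩) = 0 := b.coord_apply_ne hne
      change b.coord ⟨x, hxX⟩ (b ⟨e, heX⟩) < 1
      rw [this]
      exact one_pos
    · have hpos := hYX heY
      rw [← hb, b.interior_convexHull] at hpos
      obtain ⟨x', hx', hne⟩ : ∃ x' ∈ X, x' ≠ x := Finset.exists_mem_ne (by omega) x
      have hsum := b.sum_coord_apply_eq_one e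
      rw [← Finset.add_sum_erase _ _ (Finset.mem_univ (⟨x, hxX⟩ : X))] at hsum
      have : 0 < ∑ i ∈ Finset.univ.erase (⟨x, hxX⟩ : X), b.coord i e :=
        Finset.sum_pos (fun i _ => hpos i) ⟨⟨x', hx'⟩, by simpa using hne⟩
      change b.coord ⟨x, hxX⟩ e < 1
      linarith
  have h1 : b.coord ⟨x, hxX⟩ (b ⟨x, hxX⟩) = 1 := b.coord_apply_eq ⟨x, hxX⟩
  have h2 : b.coord ⟨x, hxX⟩ (b ⟨x, hxX⟩) < 1 := hlt hx
  linarith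

/-- A nested pair of parts of size `d + 1` can be repartitioned so that the potential
`∑ k, 3 ^ #(X ∩ convexHull (P k))` decreases: the hulls of both new parts contain fewer points of `X`
than the outer one of the old hulls. -/
theorem exists_update_lt {d r : ℕ} (hd : 1 ≤ d) (X : Finset (EuclideanSpace ℝ (Fin d)))
    [∀ Q : Finset (EuclideanSpace ℝ (Fin d)),
      DecidablePred (· ∈ convexHull ℝ (Q : Set (EuclideanSpace ℝ (Fin d))))]
    {P : Fin r → Finset (EuclideanSpace ℝ (Fin d))} {p : EuclideanSpace ℝ (Fin d)}
    (hdisj : ∀ i j, i ≠ j → Disjoint (P i) (P j))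
    (hcov : (⋃ i, (P i : Set (EuclideanSpace ℝ (Fin d)))) = (X : Set _))
    (hcard : ∀ i, (P i).card ≤ d + 1)
    (hp : ∀ i, p ∈ convexHull ℝ (P i : Set (EuclideanSpace ℝ (Fin d))))
    {i j : Fin r} (hij : i ≠ j) (hi : (P i).card = d + 1) (hj : (P j).card = d + 1)
    (hnest : convexHull ℝ (P j : Set (EuclideanSpace ℝ (Fin d))) ⊆
      interior (convexHull ℝ (P i : Set _))) :
    ∃ Q : Fin r → Finset (EuclideanSpace ℝ (Fin d)),
      (∀ i j, i ≠ j → Disjoint (Q i) (Q j)) ∧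
      (⋃ i, (Q i : Set (EuclideanSpace ℝ (Fin d)))) = (X : Set _) ∧
      (∀ i, (Q i).card ≤ d + 1) ∧
      (∀ i, p ∈ convexHull ℝ (Q i : Set (EuclideanSpace ℝ (Fin d)))) ∧
      ∑ k, 3 ^ (X.filter fun x => x ∈ convexHull ℝ (Q k : Set (EuclideanSpace ℝ (Fin d)))).card <
        ∑ k, 3 ^ (X.filter fun x => x ∈ convexHull ℝ (P k : Set (EuclideanSpace ℝ (Fin d)))).card := by
  classical
  let N : Finset (EuclideanSpace ℝ (Fin d)) → ℕ :=
    fun Q => (X.filter fun x => x ∈ convexHull ℝ (Q : Set (EuclideanSpace ℝ (Fin d)))).card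
  obtain ⟨A, B, hAB, hU, hA, hB, hAX, hBX, hpA, hpB⟩ :=
    exists_repartition hd (hdisj i j hij) hi hj (hnest (hp j)) (hp j)
  have hPX (k) : P k ⊆ X := by
    rw [← Finset.coe_subset, ← hcov]
    exact Set.subset_iUnion (fun i => (P i : Set (EuclideanSpace ℝ (Fin d)))) k
  have hlt {C : Finset (EuclideanSpace ℝ (Fin d))} (hC : C ⊆ P i ∪ P j) (hCc : C.card = d + 1)
      (hCX : C ≠ P i) : N C < N (P i) := by
    have hC' : (C : Set (EuclideanSpace ℝ (Fin d))) ⊆ P i ∪ P j := by exact_mod_cast hC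
    have hsub := (subset_convexHull ℝ (P j : Set (EuclideanSpace ℝ (Fin d)))).trans hnest
    obtain ⟨x, hx, hxC⟩ := exists_mem_notMem_convexHull hd hi hsub ⟨p, hnest (hp j)⟩ hC' hCc hCX
    refine Finset.card_lt_card (Finset.ssubset_iff_of_subset ?_ |>.2
      ⟨x, Finset.mem_filter.2 ⟨hPX i hx, subset_convexHull ℝ _ hx⟩,
        fun h => hxC (Finset.mem_filter.1 h).2⟩)
    refine Finset.monotone_filter_right X fun y _ hy => ?_
    exact convexHull_min (hC'.trans (Set.union_subset (subset_convexHull ℝ _)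
      (hsub.trans interior_subset))) (convex_convexHull ℝ _) hy
  let Q := Function.update (Function.update P i A) j B
  have hQj : Q j = B := Function.update_self ..
  have hQi : Q i = A := by simp [Q, Function.update_of_ne hij]
  have hQk {k} (h1 : k ≠ i) (h2 : k ≠ j) : Q k = P k := by
    simp [Q, Function.update_of_ne h1, Function.update_of_ne h2]
  have hcases {motive : Fin r → Prop} (h1 : motive i) (h2 : motive j)
      (h3 : ∀ k, k ≠ i → k ≠ j → motive k) (k) : motive k := by
    by_cases hki : k = i
    · exact hki ▸ h1
    · by_cases hkj : k = j
      · exact hkj ▸ h2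
      · exact h3 k hki hkj
  have hAU : A ⊆ P i ∪ P j := hU ▸ Finset.subset_union_left
  have hBU : B ⊆ P i ∪ P j := hU ▸ Finset.subset_union_right
  have hdisjU {k} (h1 : k ≠ i) (h2 : k ≠ j) : Disjoint (P i ∪ P j) (P k) :=
    Finset.disjoint_union_left.2 ⟨hdisj _ _ h1.symm, hdisj _ _ h2.symm⟩
  refine ⟨Q, ?_, ?_, ?_, ?_, ?_⟩
  · refine hcases ?_ ?_ fun k hki hkj => ?_
    · refine hcases (fun h => absurd rfl h) (fun _ => by rwa [hQi, hQj]) fun k h1 h2 _ => ?_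
      rw [hQi, hQk h1 h2]
      exact (hdisjU h1 h2).mono_left hAU
    · refine hcases (fun _ => by rw [hQi, hQj]; exact hAB.symm) (fun h => absurd rfl h)
        fun k h1 h2 _ => ?_
      rw [hQj, hQk h1 h2]
      exact (hdisjU h1 h2).mono_left hBU
    · rw [hQk hki hkj]
      refine hcases (fun _ => ?_) (fun _ => ?_) fun l h1 h2 hkl => ?_
      · rw [hQi]; exact ((hdisjU hki hkj).mono_left hAU).symm
      · rw [hQj]; exact ((hdisjU hki hkj).mono_left hBU).symm
      · rw [hQk h1 h2]; exact hdisj _ _ hkl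
  · rw [← hcov]
    have hU' (x) : x ∈ A ∨ x ∈ B ↔ x ∈ P i ∨ x ∈ P j := by
      rw [← Finset.mem_union, hU, Finset.mem_union]
    ext x
    simp only [Set.mem_iUnion, Finset.mem_coe]
    constructor
    · rintro ⟨k, hk⟩
      revert k
      refine hcases (fun h => ?_) (fun h => ?_) fun k h1 h2 h => ⟨k, hQk h1 h2 ▸ h⟩
      · exact ((hU' x).1 (Or.inl (hQi ▸ h))).elim (fun h => ⟨i, h⟩) fun h => ⟨j, h⟩
      · exact ((hU' x).1 (Or.inr (hQj ▸ h))).elim (fun h => ⟨i, h⟩) fun h => ⟨j, h⟩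
    · rintro ⟨k, hk⟩
      have hQ (h : x ∈ A ∨ x ∈ B) : ∃ k, x ∈ Q k :=
        h.elim (fun h => ⟨i, hQi.symm ▸ h⟩) fun h => ⟨j, hQj.symm ▸ h⟩
      revert k
      exact hcases (fun h => hQ ((hU' x).2 (Or.inl h))) (fun h => hQ ((hU' x).2 (Or.inr h)))
        fun k h1 h2 h => ⟨k, (hQk h1 h2).symm ▸ h⟩
  · exact hcases (by rw [hQi, hA]) (by rw [hQj, hB]) fun k h1 h2 => by
      rw [hQk h1 h2]; exact hcard k
  · exact hcases (by rw [hQi]; exact hpA) (by rw [hQj]; exact hpB) fun k h1 h2 => by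
      rw [hQk h1 h2]; exact hp k
  · change ∑ k, 3 ^ N (Q k) < ∑ k, 3 ^ N (P k)
    have hj' : j ∈ Finset.univ.erase i := Finset.mem_erase.2 ⟨hij.symm, Finset.mem_univ j⟩
    rw [← Finset.add_sum_erase _ _ (Finset.mem_univ i), ← Finset.add_sum_erase _ _ hj',
      ← Finset.add_sum_erase Finset.univ (fun k => 3 ^ N (P k)) (Finset.mem_univ i),
      ← Finset.add_sum_erase _ (fun k => 3 ^ N (P k)) hj', hQi, hQj]
    have hrest : ∑ k ∈ (Finset.univ.erase i).erase j, 3 ^ N (Q k) =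
        ∑ k ∈ (Finset.univ.erase i).erase j, 3 ^ N (P k) :=
      Finset.sum_congr rfl fun k hk => by
        rw [hQk (Finset.ne_of_mem_erase (Finset.mem_of_mem_erase hk)) (Finset.ne_of_mem_erase hk)]
    rw [hrest]
    -- both new exponents drop below the old one, and `3 ^ (n - 1) + 3 ^ (n - 1) < 3 ^ n`
    have hNA := hlt hAU hA hAX
    have hNB := hlt hBU hB hBX
    obtain ⟨n, hn⟩ : ∃ n, N (P i) = n + 1 := ⟨N (P i) - 1, by omega⟩
    have h1 : 3 ^ N A ≤ 3 ^ n := Nat.pow_le_pow_right (by norm_num) (by omega)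
    have h2 : 3 ^ N B ≤ 3 ^ n := Nat.pow_le_pow_right (by norm_num) (by omega)
    have h3 : 0 < 3 ^ n := by positivity
    have h4 : 0 < 3 ^ N (P j) := by positivity
    rw [hn, pow_succ]
    omega

/-! ### The crossing partition -/

theorem theorem3 (d r : ℕ) (hd : 2 ≤ d) (hr : 1 ≤ r) (X : Finset (EuclideanSpace ℝ (Fin d)))
    (hX_lower : (d + 1) * (r - 1) + 1 ≤ X.card) (hX_upper : X.card ≤ (d + 1) * r) :
    ∃ P : Fin r → Finset (EuclideanSpace ℝ (Fin d)),
      (∀ i j, i ≠ j → Disjoint (P i) (P j)) ∧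
      (⋃ i, (P i : Set (EuclideanSpace ℝ (Fin d)))) = (X : Set (EuclideanSpace ℝ (Fin d))) ∧
      (∀ i, (P i).card ≤ d + 1) ∧
      (∃ p : EuclideanSpace ℝ (Fin d),
        ∀ i, p ∈ convexHull ℝ (P i : Set (EuclideanSpace ℝ (Fin d)))) ∧
      (∀ i j, i ≠ j → (P i).card = d + 1 → (P j).card = d + 1 →
        Cross (convexHull ℝ (P i : Set (EuclideanSpace ℝ (Fin d))))
          (convexHull ℝ (P j : Set (EuclideanSpace ℝ (Fin d))))) := by
  classical
  obtain ⟨p, P₀, hP₀⟩ := exists_partition_of_card hr X hX_lower hX_upper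
  obtain ⟨P, ⟨hdisj, hcov, hcard, hp⟩, hmin⟩ := exists_minimalFor_of_wellFoundedLT
    (fun P : Fin r → Finset (EuclideanSpace ℝ (Fin d)) =>
      (∀ i j, i ≠ j → Disjoint (P i) (P j)) ∧
      (⋃ i, (P i : Set (EuclideanSpace ℝ (Fin d)))) = (X : Set (EuclideanSpace ℝ (Fin d))) ∧
      (∀ i, (P i).card ≤ d + 1) ∧
      ∀ i, p ∈ convexHull ℝ (P i : Set (EuclideanSpace ℝ (Fin d))))
    (fun P => ∑ k, 3 ^ (X.filter fun x => x ∈ convexHull ℝ (P k : Set _)).card) ⟨P₀, hP₀⟩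
  have hnot {i j} (hij : i ≠ j) (hi : (P i).card = d + 1) (hj : (P j).card = d + 1) :
      ¬ convexHull ℝ (P j : Set (EuclideanSpace ℝ (Fin d))) ⊆
        interior (convexHull ℝ (P i : Set _)) := by
    intro hnest
    obtain ⟨Q, h1, h2, h3, h4, hlt⟩ :=
      exists_update_lt (by omega) X hdisj hcov hcard hp hij hi hj hnest
    exact absurd (hmin ⟨h1, h2, h3, h4⟩ hlt.le) (not_le.2 hlt)
  refine ⟨P, hdisj, hcov, hcard, ⟨p, hp⟩, fun i j hij hi hj => ?_⟩
  have hrank : 1 < Module.rank ℝ (EuclideanSpace ℝ (Fin d)) := by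
    rw [← Module.finrank_eq_rank, finrank_euclideanSpace_fin]
    exact_mod_cast hd
  by_contra hcross
  rcases nested_of_frontier_inter_eq_empty hrank (convex_convexHull ℝ _) (convex_convexHull ℝ _)
    ((P i).finite_toSet.isCompact_convexHull ℝ) ((P j).finite_toSet.isCompact_convexHull ℝ)
    (hp i) (hp j) (Set.not_nonempty_iff_eq_empty.1 hcross) with h | h
  · exact hnot hij.symm hj hi h
  · exact hnot hij hi hj h
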